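/- For a metric space $M$ with a base point $0\in M$, let $\mathrm{Lip}_0(M)$ be the Banach space of Lipschitz functions $f\colon M\to\mathbb R$ with $f(0)=0$, normed by $\|f\|_L=\sup\{\frac{f(x)-f(y)}{d(x,y)}: x\neq y\}$, and let the Lipschitz free space $\mathcal F(M)$ be the norm-closed linear span of the evaluation functionals $\delta(x)\colon f\mapsto f(x)$, $x\in M$, in $\mathrm{Lip}_0(M)^*$. For $\lambda>0$, a Banach space $E$ has the $\lambda$-bounded approximation property if for all $x_1,\dots,x_n\in E$ and every $\varepsilon>0$ there is a finite-rank bounded linear operator $T\colon E\to E$ with $\|T\|\le\lambda$ and $\|x_i-Tx_i\|\le\varepsilon$ for $1\le i\le n$. **Proposition.** Let $X$ be a real Banach space and let $K\subset X$ be a closed convex subset containing $0$. Assume that there exist $\lambda\ge 1$ and a sequence $(T_n)_{n}$ of finite-rank bounded linear operators on $X$ such that $\|T_n\|\le\lambda$ and $T_n(K)\subset K$ for every $n$, and $T_nx\to x$ for every $x\in K$. Then $\mathcal F(K)$, with $0$ as base point of $K$, has the $\lambda$-bounded approximation property. -/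

import Mathlib

noncomputable section

/-- The vector space of Lipschitz functions `M → ℝ` vanishing at the base point `e`. -/
def lipZeroSubmodule (M : Type*) [MetricSpace M] (e : M) : Submodule ℝ (M → ℝ) where
  carrier := {f | (∃ C, LipschitzWith C f) ∧ f e = 0}
  zero_mem' := ⟨⟨0, LipschitzWith.const 0⟩, rfl⟩
  add_mem' := by
    rintro f g ⟨⟨C, hf⟩, hf0⟩ ⟨⟨D, hg⟩, hg0⟩
    exact ⟨⟨C + D, hf.add hg⟩, by simp [hf0, hg0]⟩
  smul_mem' := by
    rintro c f ⟨⟨C, hf⟩, hf0⟩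
    exact ⟨⟨‖c‖₊ * C, (lipschitzWith_smul c).comp hf⟩, by simp [hf0]⟩

/-- `Lip₀(M)`. This is a type of its own, so that it carries the Lipschitz norm and not the
topology of pointwise convergence. -/
def LipZero (M : Type*) [MetricSpace M] (e : M) : Type _ := lipZeroSubmodule M e

namespace LipZero

variable {M : Type*} [MetricSpace M] {e : M}

instance : AddCommGroup (LipZero M e) := inferInstanceAs (AddCommGroup (lipZeroSubmodule M e))

instance : Module ℝ (LipZero M e) := inferInstanceAs (Module ℝ (lipZeroSubmodule M e))

instance : CoeFun (LipZero M e) (fun _ => M → ℝ) := ⟨fun f => f.1⟩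

theorem ext_fun {f g : LipZero M e} (h : ∀ x, f x = g x) : f = g := Subtype.ext (funext h)

theorem add_apply (f g : LipZero M e) (x : M) : (f + g) x = f x + g x := rfl

theorem smul_apply (c : ℝ) (f : LipZero M e) (x : M) : (c • f) x = c * f x := rfl

theorem zero_apply (x : M) : (0 : LipZero M e) x = 0 := rfl

theorem apply_base (f : LipZero M e) : f e = 0 := f.2.2

/-- The difference quotients of a function. -/
def slopes (f : M → ℝ) : Set ℝ := {r | ∃ x y : M, x ≠ y ∧ r = (f x - f y) / dist x y}

/-- The norm `‖f‖_L = sup {(f x - f y) / d(x, y) : x ≠ y}` (equal to `0` on a one-point space). -/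
instance : Norm (LipZero M e) := ⟨fun f => sSup (slopes f)⟩

theorem norm_def (f : LipZero M e) : ‖f‖ = sSup (slopes f) := rfl

theorem bddAbove_slopes (f : LipZero M e) : BddAbove (slopes f) := by
  obtain ⟨C, hC⟩ := f.2.1
  refine ⟨C, ?_⟩
  rintro r ⟨x, y, hxy, rfl⟩
  rw [div_le_iff₀ (dist_pos.2 hxy)]
  exact (le_abs_self _).trans (hC.dist_le_mul x y)

theorem sub_le_norm_mul (f : LipZero M e) (x y : M) : f x - f y ≤ ‖f‖ * dist x y := by
  rcases eq_or_ne x y with rfl | h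
  · simp
  · rw [← div_le_iff₀ (dist_pos.2 h)]
    exact le_csSup (bddAbove_slopes f) ⟨x, y, h, rfl⟩

theorem norm_le_of (f : LipZero M e) {C : ℝ} (hC : 0 ≤ C)
    (h : ∀ x y, f x - f y ≤ C * dist x y) : ‖f‖ ≤ C := by
  refine Real.sSup_le ?_ hC
  rintro r ⟨x, y, hxy, rfl⟩
  rw [div_le_iff₀ (dist_pos.2 hxy)]
  exact h x y

theorem norm_nonneg_aux (f : LipZero M e) : 0 ≤ ‖f‖ := by
  by_cases h : ∃ x y : M, x ≠ y
  · obtain ⟨x, y, hxy⟩ := h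
    have h1 := sub_le_norm_mul f x y
    have h2 := sub_le_norm_mul f y x
    rw [dist_comm y x] at h2
    have h3 := dist_pos.2 hxy
    by_contra hn
    nlinarith [mul_pos (neg_pos.2 (not_le.1 hn)) h3]
  · refine Real.sSup_nonneg ?_
    rintro r ⟨x, y, hxy, rfl⟩
    exact absurd ⟨x, y, hxy⟩ h

theorem norm_smul_le_aux (c : ℝ) (f : LipZero M e) : ‖c • f‖ ≤ ‖c‖ * ‖f‖ := by
  refine norm_le_of _ (mul_nonneg (norm_nonneg c) (norm_nonneg_aux f)) fun x y => ?_
  rw [smul_apply, smul_apply, ← mul_sub, mul_assoc]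
  refine (le_abs_self _).trans ?_
  rw [abs_mul, Real.norm_eq_abs]
  refine mul_le_mul_of_nonneg_left (abs_le.2 ⟨?_, sub_le_norm_mul f x y⟩) (abs_nonneg c)
  have := sub_le_norm_mul f y x
  rw [dist_comm y x] at this
  linarith

theorem norm_core : NormedSpace.Core ℝ (LipZero M e) where
  norm_nonneg := norm_nonneg_aux
  norm_smul c f := by
    refine le_antisymm (norm_smul_le_aux c f) ?_
    rcases eq_or_ne c 0 with rfl | hc
    · simpa using norm_nonneg_aux ((0 : ℝ) • f)
    · have h := norm_smul_le_aux c⁻¹ (c • f)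
      rw [inv_smul_smul₀ hc, norm_inv] at h
      have hc' : 0 < ‖c‖ := norm_pos_iff.2 hc
      calc ‖c‖ * ‖f‖ ≤ ‖c‖ * (‖c‖⁻¹ * ‖c • f‖) := mul_le_mul_of_nonneg_left h hc'.le
        _ = ‖c • f‖ := by rw [← mul_assoc, mul_inv_cancel₀ hc'.ne', one_mul]
  norm_triangle f g := by
    refine norm_le_of _ (add_nonneg (norm_nonneg_aux f) (norm_nonneg_aux g)) fun x y => ?_
    have h1 := sub_le_norm_mul f x y
    have h2 := sub_le_norm_mul g x y
    rw [add_apply, add_apply, add_mul]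
    linarith
  norm_eq_zero_iff f := by
    constructor
    · intro h
      refine ext_fun fun x => ?_
      have h1 := sub_le_norm_mul f x e
      have h2 := sub_le_norm_mul f e x
      rw [h, zero_mul, apply_base] at h1 h2
      rw [zero_apply]
      linarith
    · rintro rfl
      refine le_antisymm (norm_le_of _ le_rfl fun x y => ?_) (norm_nonneg_aux _)
      simp [zero_apply]

instance : NormedAddCommGroup (LipZero M e) := NormedAddCommGroup.ofCore norm_core

instance : NormedSpace ℝ (LipZero M e) := NormedSpace.ofCore norm_core

/-- The evaluation functional `δ(x) : f ↦ f x`, an element of `Lip₀(M)^*`. -/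
def delta (e x : M) : StrongDual ℝ (LipZero M e) :=
  LinearMap.mkContinuous
    { toFun := fun f => f x
      map_add' := fun f g => add_apply f g x
      map_smul' := fun c f => smul_apply c f x }
    (dist x e) (fun f => by
      have h1 := sub_le_norm_mul f x e
      have h2 := sub_le_norm_mul f e x
      rw [dist_comm e x] at h2
      rw [apply_base] at h1 h2
      change |f x| ≤ dist x e * ‖f‖
      rw [mul_comm]
      exact abs_le.2 ⟨by linarith, by linarith⟩)

end LipZero

/-- The Lipschitz free space `F(M)`: the norm-closed linear span of the evaluation functionals
in `Lip₀(M)^*`, with the dual norm. -/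
abbrev LipschitzFree (M : Type*) [MetricSpace M] (e : M) : Type _ :=
  (Submodule.span ℝ (Set.range (LipZero.delta e))).topologicalClosure

/-- The `l`-bounded approximation property, for `l > 0`. -/
def HasBAP (l : ℝ) (E : Type*) [NormedAddCommGroup E] [NormedSpace ℝ E] : Prop :=
  0 < l ∧ ∀ (n : ℕ) (x : Fin n → E) (ε : ℝ), 0 < ε →
    ∃ T : E →L[ℝ] E, FiniteDimensional ℝ T.range ∧ ‖T‖ ≤ l ∧ ∀ i, ‖x i - T (x i)‖ ≤ ε

end

/-!
By the universal property of the free space, a finite-rank `l`-Lipschitz map from `M` to `F(M)`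
which is close to `δ` at finitely many points extends to a finite-rank operator of norm at most `l`
which is close to the identity on the span of these points. So it suffices to approximate `δ` on
finite sets by such maps. A radial contraction followed by some `T n` maps `K` into a bounded convex
set `C` that spans a finite-dimensional space and lies in `K`, and the task becomes to approximate
the nonexpansive map `δ` on `C` by nonexpansive maps of finite rank. Precomposing `δ` with a
homothety of ratio `q < 1` about a relative interior point of `C` makes it `q`-Lipschitz on a
neighbourhood of `C`. It remains so on `C` after convolution with a bump function, and a kernel in
the span of the functions `exp ∘ φ`, `φ` linear, which is uniformly close to the bump function
changes the Lipschitz constant by less than `1 - q`. Convolution with such a kernel has finite rank.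
-/

open Filter Set Topology
open scoped NNReal

section FiniteRank

variable {α β V : Type*} [AddCommGroup V] [Module ℝ V] {f g : α → V}

/-- A map with values in a vector space, not assumed linear, has finite rank if its values span a
finite-dimensional subspace. -/
def HasFiniteRank (f : α → V) : Prop :=
  FiniteDimensional ℝ (Submodule.span ℝ (range f))

namespace HasFiniteRank

theorem of_forall_mem (W : Submodule ℝ V) [FiniteDimensional ℝ W] (h : ∀ a, f a ∈ W) :
    HasFiniteRank f :=
  Submodule.finiteDimensional_of_le (Submodule.span_le.2 (range_subset_iff.2 h))

theorem comp (hf : HasFiniteRank f) (u : β → α) : HasFiniteRank (f ∘ u) :=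
  have : FiniteDimensional ℝ (Submodule.span ℝ (range f)) := hf
  of_forall_mem _ fun b => Submodule.subset_span (mem_range_self (u b))

theorem add (hf : HasFiniteRank f) (hg : HasFiniteRank g) : HasFiniteRank fun a => f a + g a :=
  have : FiniteDimensional ℝ (Submodule.span ℝ (range f)) := hf
  have : FiniteDimensional ℝ (Submodule.span ℝ (range g)) := hg
  of_forall_mem (Submodule.span ℝ (range f) ⊔ Submodule.span ℝ (range g)) fun a =>
    Submodule.add_mem_sup (Submodule.subset_span (mem_range_self a))
      (Submodule.subset_span (mem_range_self a))

theorem const (v : V) : HasFiniteRank fun _ : α => v :=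
  of_forall_mem (Submodule.span ℝ {v}) fun _ => Submodule.mem_span_singleton_self v

theorem const_smul (hf : HasFiniteRank f) (c : ℝ) : HasFiniteRank fun a => c • f a :=
  have : FiniteDimensional ℝ (Submodule.span ℝ (range f)) := hf
  of_forall_mem _ fun a => Submodule.smul_mem _ c (Submodule.subset_span (mem_range_self a))

end HasFiniteRank

end FiniteRank

section BoundedApproximation

variable {E F ι : Type*} [NormedAddCommGroup E] [NormedSpace ℝ E] [NormedAddCommGroup F]
  [NormedSpace ℝ F]

theorem tendsto_clm_apply_of_dense_span {u : Filter ι} {S : ι → E →L[ℝ] F} {C : ℝ≥0}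
    (hS : ∀ i, ‖S i‖ ≤ C) {A : Set E} (hA : Dense (Submodule.span ℝ A : Set E)) {S₀ : E →L[ℝ] F}
    (h : ∀ a ∈ A, Tendsto (fun i => S i a) u (𝓝 (S₀ a))) (x : E) :
    Tendsto (fun i => S i x) u (𝓝 (S₀ x)) := by
  have h_span : ∀ y ∈ Submodule.span ℝ A, Tendsto (fun i => S i y) u (𝓝 (S₀ y)) := by
    intro y hy
    induction hy using Submodule.span_induction with
    | mem a ha => exact h a ha
    | zero => simpa only [map_zero] using tendsto_const_nhds
    | add y z _ _ hy hz => simpa only [map_add] using hy.add hz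
    | smul c y _ hy => simpa only [map_smul] using hy.const_smul c
  have h_equi : Equicontinuous fun i => ⇑(S i) :=
    (LipschitzWith.uniformEquicontinuous _ C fun i =>
      ContinuousLinearMap.lipschitzWith_of_opNorm_le (hS i)).equicontinuous
  have h_closed : IsClosed {y | Tendsto (fun i => S i y) u (𝓝 (S₀ y))} :=
    h_equi.isClosed_setOfPred_tendsto S₀.continuous
  exact h_closed.closure_subset_iff.2 h_span (hA x)

theorem hasBAP_of_dense_span_range {d : ι → E} (hd : Dense (Submodule.span ℝ (range d) : Set E))
    {l : ℝ≥0} (hl : 0 < l)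
    (h : ∀ (P : Finset ι) (ε : ℝ), 0 < ε → ∃ S : E →L[ℝ] E,
      FiniteDimensional ℝ S.range ∧ ‖S‖ ≤ l ∧ ∀ p ∈ P, ‖d p - S (d p)‖ ≤ ε) :
    HasBAP l E := by
  refine ⟨hl, fun n x ε hε => ?_⟩
  classical
  choose S hS_fin hS_norm hS_near using fun i : Finset ι × ℕ =>
    h i.1 (1 / (i.2 + 1)) Nat.one_div_pos_of_nat
  have h_point (p : ι) : Tendsto (fun i => S i (d p)) atTop (𝓝 (d p)) := by
    have h_bound : Tendsto (fun i : Finset ι × ℕ => 1 / ((i.2 : ℝ) + 1)) atTop (𝓝 0) := by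
      rw [← prod_atTop_atTop_eq]
      exact tendsto_one_div_add_atTop_nhds_zero_nat.comp tendsto_snd
    rw [tendsto_iff_dist_tendsto_zero]
    refine squeeze_zero' (Eventually.of_forall fun _ => dist_nonneg) ?_ h_bound
    filter_upwards [eventually_ge_atTop (({p}, 0) : Finset ι × ℕ)] with i hi
    rw [dist_eq_norm']
    exact hS_near i p (Finset.singleton_subset_iff.1 hi.1)
  have h_tendsto (y : E) : Tendsto (fun i => S i y) atTop (𝓝 y) :=
    tendsto_clm_apply_of_dense_span hS_norm hd (S₀ := .id ℝ E) (forall_mem_range.2 h_point) y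
  have h_near (j : Fin n) : ∀ᶠ i in atTop, ‖x j - S i (x j)‖ < ε := by
    simpa only [dist_eq_norm'] using (h_tendsto (x j)).eventually (Metric.ball_mem_nhds _ hε)
  obtain ⟨i, hi⟩ := (eventually_all.2 h_near).exists
  exact ⟨S i, hS_fin i, hS_norm i, fun j => (hi j).le⟩

end BoundedApproximation

/-- `δ` exhibits `E` as the Lipschitz free space of `(M, e)`. The first three fields say that `δ` is
nonexpansive, vanishes at the base point and spans a dense subspace; the last one says that the norm
on this subspace is the largest one for which `δ` is nonexpansive. Working with this property keeps
the argument independent of how the free space is constructed. -/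
structure IsFreeEmbedding {M E : Type*} [MetricSpace M] [NormedAddCommGroup E] [NormedSpace ℝ E]
    (e : M) (δ : M → E) : Prop where
  lipschitzWith : LipschitzWith 1 δ
  map_base : δ e = 0
  dense_span : Dense (Submodule.span ℝ (range δ) : Set E)
  abs_linearCombination_le {L : ℝ≥0} {f : M → ℝ} (hf : LipschitzWith L f) (h0 : f e = 0)
    (a : M →₀ ℝ) :
    |Finsupp.linearCombination ℝ f a| ≤ L * ‖Finsupp.linearCombination ℝ δ a‖

namespace IsFreeEmbedding

variable {M E V : Type*} [MetricSpace M] {e : M} [NormedAddCommGroup E] [NormedSpace ℝ E]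
  [NormedAddCommGroup V] [NormedSpace ℝ V] {δ : M → E}

theorem norm_linearCombination_le (hδ : IsFreeEmbedding e δ) {φ : M → V} {L : ℝ≥0}
    (hφ : LipschitzWith L φ) (h0 : φ e = 0) (a : M →₀ ℝ) :
    ‖Finsupp.linearCombination ℝ φ a‖ ≤ L * ‖Finsupp.linearCombination ℝ δ a‖ := by
  refine NormedSpace.norm_le_dual_bound ℝ _ (by positivity) fun ℓ => ?_
  have h : |Finsupp.linearCombination ℝ (ℓ ∘ φ) a| ≤
      (‖ℓ‖₊ * L : ℝ≥0) * ‖Finsupp.linearCombination ℝ δ a‖ :=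
    hδ.abs_linearCombination_le (ℓ.lipschitz.comp hφ) (by simp [h0]) a
  have h_apply : ℓ (Finsupp.linearCombination ℝ φ a) = Finsupp.linearCombination ℝ (ℓ ∘ φ) a :=
    Finsupp.apply_linearCombination ℝ ℓ.toLinearMap φ a
  calc ‖ℓ (Finsupp.linearCombination ℝ φ a)‖
      ≤ (‖ℓ‖₊ * L : ℝ≥0) * ‖Finsupp.linearCombination ℝ δ a‖ := h_apply ▸ h
    _ = L * ‖Finsupp.linearCombination ℝ δ a‖ * ‖ℓ‖ := by
      rw [NNReal.coe_mul, coe_nnnorm]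
      ring

theorem exists_lift (hδ : IsFreeEmbedding e δ) [CompleteSpace V] {φ : M → V} {L : ℝ≥0}
    (hφ : LipschitzWith L φ) (h0 : φ e = 0) :
    ∃ S : E →L[ℝ] V, ‖S‖ ≤ L ∧ ∀ x, S (δ x) = φ x := by
  have h_norm := hδ.norm_linearCombination_le hφ h0
  have h_dense : DenseRange (Finsupp.linearCombination ℝ δ) := by
    rw [DenseRange, ← LinearMap.coe_range, Finsupp.range_linearCombination]
    exact hδ.dense_span
  refine ⟨(Finsupp.linearCombination ℝ φ).extendOfNorm (Finsupp.linearCombination ℝ δ),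
    LinearMap.opNorm_extendOfNorm_le h_dense L.2 h_norm, fun x => ?_⟩
  simpa using LinearMap.extendOfNorm_eq h_dense ⟨L, h_norm⟩ (Finsupp.single x 1)

theorem finiteDimensional_range (hδ : IsFreeEmbedding e δ) {S : E →L[ℝ] V}
    (hS : HasFiniteRank (S ∘ δ)) : FiniteDimensional ℝ S.range := by
  set W := Submodule.span ℝ (range (S ∘ δ))
  have : FiniteDimensional ℝ W := hS
  have h_span : Submodule.span ℝ (range δ) ≤ W.comap S.toLinearMap :=
    Submodule.span_le.2 (range_subset_iff.2 fun x => Submodule.subset_span (mem_range_self x))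
  have h_closed : IsClosed (S ⁻¹' W) := W.closed_of_finiteDimensional.preimage S.continuous
  refine Submodule.finiteDimensional_of_le (S₂ := W) ?_
  rintro _ ⟨m, rfl⟩
  exact h_closed.closure_subset_iff.2 h_span (hδ.dense_span m)

theorem hasBAP_of_forall_finset [CompleteSpace E] (hδ : IsFreeEmbedding e δ) {l : ℝ≥0} (hl : 0 < l)
    (h : ∀ (P : Finset M) (ε : ℝ), 0 < ε → ∃ φ : M → E,
      HasFiniteRank φ ∧ LipschitzWith l φ ∧ ∀ p ∈ P, dist (φ p) (δ p) ≤ ε) :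
    HasBAP l E := by
  classical
  refine hasBAP_of_dense_span_range hδ.dense_span hl fun P ε hε => ?_
  obtain ⟨φ, hφ_rank, hφ_lip, hφ_near⟩ := h (insert e P) (ε / 2) (half_pos hε)
  have h_base : ‖φ e‖ ≤ ε / 2 := by
    simpa [hδ.map_base] using hφ_near e (Finset.mem_insert_self e P)
  have hψ_rank : HasFiniteRank fun x => φ x - φ e := by
    simpa only [sub_eq_add_neg] using hφ_rank.add (.const (-φ e))
  have hψ_lip : LipschitzWith l fun x => φ x - φ e := by
    simpa using hφ_lip.sub (LipschitzWith.const (φ e))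
  obtain ⟨S, hS_norm, hS⟩ := hδ.exists_lift hψ_lip (sub_self _)
  have hS_comp : S ∘ δ = fun x => φ x - φ e := funext hS
  refine ⟨S, hδ.finiteDimensional_range (hS_comp ▸ hψ_rank), hS_norm, fun p hp => ?_⟩
  have h_near : dist (φ p) (δ p) ≤ ε / 2 := hφ_near p (Finset.mem_insert_of_mem hp)
  calc ‖δ p - S (δ p)‖ = ‖φ e - (φ p - δ p)‖ := by rw [hS]; congr 1; abel
    _ ≤ ‖φ e‖ + ‖φ p - δ p‖ := norm_sub_le _ _
    _ ≤ ε := by rw [← dist_eq_norm]; linarith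

end IsFreeEmbedding

namespace LipZero

variable {M : Type*} [MetricSpace M] {e : M}

theorem delta_apply (x : M) (f : LipZero M e) : delta e x f = f x := rfl

theorem delta_base : delta e e = 0 := by
  ext f
  exact f.apply_base

theorem lipschitzWith_delta : LipschitzWith 1 (delta e) := by
  refine LipschitzWith.of_dist_le_mul fun x y => ?_
  rw [NNReal.coe_one, one_mul, dist_eq_norm]
  refine ContinuousLinearMap.opNorm_le_bound _ dist_nonneg fun f => ?_
  have h := sub_le_norm_mul f y x
  rw [dist_comm] at h
  rw [sub_apply, delta_apply, delta_apply, Real.norm_eq_abs, mul_comm, abs_le]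
  exact ⟨by linarith, sub_le_norm_mul f x y⟩

theorem linearCombination_delta_apply (a : M →₀ ℝ) (f : LipZero M e) :
    Finsupp.linearCombination ℝ (delta e) a f = Finsupp.linearCombination ℝ f a :=
  Finsupp.apply_linearCombination ℝ (ContinuousLinearMap.apply ℝ ℝ f).toLinearMap (delta e) a

theorem abs_linearCombination_le {L : ℝ≥0} {f : M → ℝ} (hf : LipschitzWith L f) (h0 : f e = 0)
    (a : M →₀ ℝ) :
    |Finsupp.linearCombination ℝ f a| ≤ L * ‖Finsupp.linearCombination ℝ (delta e) a‖ := by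
  let g : LipZero M e := ⟨f, ⟨L, hf⟩, h0⟩
  have hg : ‖g‖ ≤ L := norm_le_of _ L.2 fun x y => (le_abs_self _).trans (hf.dist_le_mul x y)
  calc |Finsupp.linearCombination ℝ f a| = ‖Finsupp.linearCombination ℝ (delta e) a g‖ := by
        rw [linearCombination_delta_apply, Real.norm_eq_abs]
    _ ≤ ‖Finsupp.linearCombination ℝ (delta e) a‖ * ‖g‖ := ContinuousLinearMap.le_opNorm _ _
    _ ≤ ‖Finsupp.linearCombination ℝ (delta e) a‖ * L := by gcongr
    _ = L * ‖Finsupp.linearCombination ℝ (delta e) a‖ := mul_comm _ _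

end LipZero

namespace LipschitzFree

variable {M : Type*} [MetricSpace M]

/-- The canonical embedding `δ : M → F(M)`. -/
noncomputable def ofPoint (e x : M) : LipschitzFree M e :=
  ⟨LipZero.delta e x, Submodule.le_topologicalClosure _ (Submodule.subset_span (mem_range_self x))⟩

theorem dense_span_range_ofPoint (e : M) :
    Dense (Submodule.span ℝ (range (ofPoint e)) : Set (LipschitzFree M e)) := by
  rw [Subtype.dense_iff, ← Submodule.coe_subtype, ← Submodule.map_coe, Submodule.map_span,
    ← range_comp]
  exact subset_rfl

theorem isFreeEmbedding_ofPoint (e : M) : IsFreeEmbedding e (ofPoint e) where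
  lipschitzWith := LipZero.lipschitzWith_delta.subtype_mk _
  map_base := Subtype.ext LipZero.delta_base
  dense_span := dense_span_range_ofPoint e
  abs_linearCombination_le hf h0 a := by
    have h_coe : (Finsupp.linearCombination ℝ (ofPoint e) a : StrongDual ℝ (LipZero M e)) =
        Finsupp.linearCombination ℝ (LipZero.delta e) a :=
      Finsupp.apply_linearCombination ℝ (Submodule.subtype _) (ofPoint e) a
    exact (LipZero.abs_linearCombination_le hf h0 a).trans_eq (by rw [← h_coe, Submodule.coe_norm])

end LipschitzFree

section ExponentialKernels

/-- The multiplicative monoid of the functions `x ↦ exp (φ x)`, for `φ` a continuous linear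
functional. Its linear span is an algebra, to which the Stone-Weierstrass theorem applies. -/
def expLinear (E : Type*) [NormedAddCommGroup E] [NormedSpace ℝ E] : Submonoid C(E, ℝ) where
  carrier := range fun φ : StrongDual ℝ E => ⟨fun x => Real.exp (φ x), by fun_prop⟩
  one_mem' := ⟨0, by ext; simp⟩
  mul_mem' := by
    rintro _ _ ⟨φ, rfl⟩ ⟨ψ, rfl⟩
    exact ⟨φ + ψ, by ext; simp [Real.exp_add]⟩

theorem separatesPoints_adjoin_expLinear (E : Type*) [NormedAddCommGroup E] [NormedSpace ℝ E] :
    (Algebra.adjoin ℝ (expLinear E : Set C(E, ℝ))).SeparatesPoints := by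
  intro x y hxy
  obtain ⟨φ, hφ⟩ := SeparatingDual.exists_separating_of_ne (R := ℝ) hxy
  exact ⟨fun x => Real.exp (φ x), ⟨⟨fun x => Real.exp (φ x), by fun_prop⟩,
    Algebra.subset_adjoin ⟨φ, rfl⟩, rfl⟩, Real.exp_injective.ne hφ⟩

theorem exists_mem_span_expLinear_near {E : Type*} [NormedAddCommGroup E] [NormedSpace ℝ E]
    (k : C(E, ℝ)) {Q : Set E} (hQ : IsCompact Q) {ε : ℝ} (hε : 0 < ε) :
    ∃ p ∈ Submodule.span ℝ (expLinear E : Set C(E, ℝ)), ∀ x ∈ Q, ‖p x - k x‖ < ε := by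
  obtain ⟨p, hp, h⟩ :=
    ContinuousMap.exists_mem_subalgebra_near_continuous_of_isCompact_of_separatesPoints
      (separatesPoints_adjoin_expLinear E) k hQ hε
  rw [← Subalgebra.mem_toSubmodule, Algebra.adjoin_eq_span, Submonoid.closure_eq] at hp
  exact ⟨p, hp, h⟩

end ExponentialKernels

section Convolution

open MeasureTheory ContinuousLinearMap Metric
open scoped Convolution Pointwise

theorem convolution_lsmul_sub_convolution {E V : Type*} [AddGroup E] [MeasurableSpace E]
    {μ : Measure E} [NormedAddCommGroup V] [NormedSpace ℝ V] {h : E → ℝ} {F : E → V} {x y : E}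
    (hx : ConvolutionExistsAt h F x (lsmul ℝ ℝ) μ) (hy : ConvolutionExistsAt h F y (lsmul ℝ ℝ) μ) :
    (h ⋆[lsmul ℝ ℝ, μ] F) x - (h ⋆[lsmul ℝ ℝ, μ] F) y =
      ∫ z, h z • (F (x - z) - F (y - z)) ∂μ := by
  rw [convolution_def, convolution_def, ← integral_sub hx hy]
  simp only [lsmul_apply, smul_sub]

theorem norm_integral_smul_le_of_isCompact {E V : Type*} [TopologicalSpace E] [MeasurableSpace E]
    {μ : Measure E} [IsFiniteMeasureOnCompacts μ] [NormedAddCommGroup V] [NormedSpace ℝ V]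
    {Q : Set E} (hQ : IsCompact Q) {h : E → ℝ} {G : E → V} {d B : ℝ} (hd : 0 ≤ d)
    (hh : ∀ z ∈ Q, ‖h z‖ ≤ d) (hGB : ∀ z, ‖G z‖ ≤ B) (hG : ∀ z ∉ Q, G z = 0) :
    ‖∫ z, h z • G z ∂μ‖ ≤ d * B * μ.real Q := by
  have h_zero : ∀ z ∉ Q, h z • G z = 0 := fun z hz => by rw [hG z hz, smul_zero]
  rw [← setIntegral_eq_integral_of_forall_compl_eq_zero h_zero]
  refine norm_setIntegral_le_of_norm_le_const hQ.measure_lt_top fun z hz => ?_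
  rw [norm_smul]
  exact mul_le_mul (hh z hz) (hGB z) (norm_nonneg _) hd

theorem apply_sub_eq_zero_of_notMem_sub_tsupport {E V : Type*} [AddCommGroup E]
    [TopologicalSpace E] [Zero V] {F : E → V} {Q : Set E} {x z : E} (hx : x ∈ Q)
    (hz : z ∉ Q - tsupport F) : F (x - z) = 0 := by
  by_contra h
  exact hz ⟨x, hx, x - z, subset_tsupport F h, sub_sub_cancel x z⟩

theorem norm_convolution_le_of_norm_le {E V : Type*} [AddCommGroup E] [TopologicalSpace E]
    [MeasurableSpace E] (μ : Measure E) [IsFiniteMeasureOnCompacts μ] [NormedAddCommGroup V]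
    [NormedSpace ℝ V] {F : E → V} {Q : Set E} (hQ : IsCompact (Q - tsupport F)) {k : E → ℝ}
    {d B : ℝ} (hd : 0 ≤ d) (hk : ∀ z ∈ Q - tsupport F, ‖k z‖ ≤ d) (hB : ∀ z, ‖F z‖ ≤ B) {x : E}
    (hx : x ∈ Q) : ‖(k ⋆[lsmul ℝ ℝ, μ] F) x‖ ≤ d * B * μ.real (Q - tsupport F) :=
  norm_integral_smul_le_of_isCompact hQ hd hk (fun z => hB (x - z)) fun _ hz =>
    apply_sub_eq_zero_of_notMem_sub_tsupport hx hz

variable {E V : Type*} [NormedAddCommGroup E] [NormedSpace ℝ E] [FiniteDimensional ℝ E]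
  [MeasurableSpace E] [BorelSpace E] (μ : Measure E) [μ.IsAddHaarMeasure] [NormedAddCommGroup V]
  [NormedSpace ℝ V] {F : E → V}

theorem convolutionExists_continuousMap (hF : Continuous F) (hF_supp : HasCompactSupport F)
    (k : C(E, ℝ)) : ConvolutionExists k F (lsmul ℝ ℝ) μ :=
  hF_supp.convolutionExists_right _ k.continuous.locallyIntegrable hF

theorem convolution_continuousMap_sub (hF : Continuous F) (hF_supp : HasCompactSupport F)
    (p k : C(E, ℝ)) (x : E) :
    (p ⋆[lsmul ℝ ℝ, μ] F) x - (k ⋆[lsmul ℝ ℝ, μ] F) x = (↑(p - k) ⋆[lsmul ℝ ℝ, μ] F) x := by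
  have h_exists := convolutionExists_continuousMap μ hF hF_supp
  rw [sub_eq_iff_eq_add, ← (h_exists (p - k) x).add_distrib (h_exists k x),
    ← ContinuousMap.coe_add, sub_add_cancel]

-- A kernel `exp ∘ φ` separates the variables: `exp (φ (x - t)) = exp (φ x) * exp (-φ t)`.
theorem hasFiniteRank_convolution_of_mem_span_expLinear (hF : Continuous F)
    (hF_supp : HasCompactSupport F) {p : C(E, ℝ)}
    (hp : p ∈ Submodule.span ℝ (expLinear E : Set C(E, ℝ))) :
    HasFiniteRank (p ⋆[lsmul ℝ ℝ, μ] F) := by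
  have h_exists := convolutionExists_continuousMap μ hF hF_supp
  induction hp using Submodule.span_induction with
  | mem p hp =>
    obtain ⟨φ, rfl⟩ := hp
    refine .of_forall_mem (Submodule.span ℝ {∫ t, Real.exp (-φ t) • F t ∂μ}) fun x =>
      Submodule.mem_span_singleton.2 ⟨Real.exp (φ x), ?_⟩
    have h_exp (t : E) : Real.exp (φ (x - t)) = Real.exp (φ x) * Real.exp (-φ t) := by
      rw [map_sub, sub_eq_add_neg, Real.exp_add]
    simp only [convolution_lsmul_swap, ContinuousMap.coe_mk, h_exp, mul_smul, integral_smul]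
  | zero =>
    rw [ContinuousMap.coe_zero, zero_convolution]
    exact .const 0
  | add p q _ _ hp hq =>
    rw [ContinuousMap.coe_add, (h_exists p).add_distrib (h_exists q)]
    exact hp.add hq
  | smul a p _ hp =>
    rw [ContinuousMap.coe_smul, smul_convolution]
    exact hp.const_smul a

theorem dist_convolution_le_of_norm_le {M : ℝ≥0} (hF : LipschitzWith M F)
    (hF_supp : HasCompactSupport F) {Q : Set E} (hQ : IsCompact (Q - tsupport F)) {k : C(E, ℝ)}
    {d : ℝ} (hd : 0 ≤ d) (hk : ∀ z ∈ Q - tsupport F, ‖k z‖ ≤ d) {x y : E} (hx : x ∈ Q)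
    (hy : y ∈ Q) :
    dist ((k ⋆[lsmul ℝ ℝ, μ] F) x) ((k ⋆[lsmul ℝ ℝ, μ] F) y) ≤
      d * (M * dist x y) * μ.real (Q - tsupport F) := by
  have h_exists := convolutionExists_continuousMap μ hF.continuous hF_supp k
  have hF_sub (z : E) : ‖F (x - z) - F (y - z)‖ ≤ M * dist x y := by
    simpa [dist_eq_norm] using hF.dist_le_mul (x - z) (y - z)
  rw [dist_eq_norm, convolution_lsmul_sub_convolution (h_exists x) (h_exists y)]
  refine norm_integral_smul_le_of_isCompact hQ hd hk hF_sub fun z hz => ?_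
  rw [apply_sub_eq_zero_of_notMem_sub_tsupport hx hz,
    apply_sub_eq_zero_of_notMem_sub_tsupport hy hz, sub_zero]

theorem exists_hasFiniteRank_near_convolution (k : C(E, ℝ)) {M : ℝ≥0} (hF : LipschitzWith M F)
    (hF_supp : HasCompactSupport F) {C : Set E} (hC : Bornology.IsBounded C) {ε : ℝ≥0}
    (hε : 0 < ε) :
    ∃ φ : E → V, HasFiniteRank φ ∧ LipschitzOnWith ε (fun x => φ x - (k ⋆[lsmul ℝ ℝ, μ] F) x) C ∧
      ∀ x ∈ C, ‖φ x - (k ⋆[lsmul ℝ ℝ, μ] F) x‖ ≤ ε := by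
  obtain ⟨B, hB⟩ := hF.continuous.bounded_above_of_compact_support hF_supp
  have hB0 : 0 ≤ B := (norm_nonneg _).trans (hB 0)
  have hQ : IsCompact (closure C - tsupport F) := by
    rw [sub_eq_add_neg]
    exact hC.isCompact_closure.add hF_supp.isCompact.neg
  set m := μ.real (closure C - tsupport F)
  have hm : 0 ≤ m := measureReal_nonneg
  have hN : 0 < (M + B) * m + 1 :=
    add_pos_of_nonneg_of_pos (mul_nonneg (add_nonneg M.2 hB0) hm) one_pos
  set d := ε / ((M + B) * m + 1)
  have hd : 0 < d := div_pos hε hN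
  have hd_eq : d * M * m + d * B * m + d = ε := by
    rw [← div_mul_cancel₀ (ε : ℝ) hN.ne']
    ring
  have hdM : 0 ≤ d * M * m := by positivity
  have hdB : 0 ≤ d * B * m := by positivity
  obtain ⟨p, hp, hpk⟩ := exists_mem_span_expLinear_near k hQ hd
  have h_sub := convolution_continuousMap_sub μ hF.continuous hF_supp p k
  refine ⟨p ⋆[lsmul ℝ ℝ, μ] F,
    hasFiniteRank_convolution_of_mem_span_expLinear μ hF.continuous hF_supp hp,
    LipschitzOnWith.of_dist_le_mul fun x hx y hy => ?_, fun x hx => ?_⟩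
  · rw [h_sub, h_sub]
    calc _ ≤ d * (M * dist x y) * m := dist_convolution_le_of_norm_le μ hF hF_supp hQ hd.le
          (fun z hz => (hpk z hz).le) (subset_closure hx) (subset_closure hy)
      _ = d * M * m * dist x y := by ring
      _ ≤ ε * dist x y := by gcongr; linarith
  · rw [h_sub]
    calc _ ≤ d * B * m := norm_convolution_le_of_norm_le μ hQ hd.le
          (fun z hz => (hpk z hz).le) hB (subset_closure hx)
      _ ≤ ε := by linarith

theorem lipschitzOnWith_normed_convolution (ψ : ContDiffBump (0 : E)) (hF : Continuous F)
    {C : Set E} {L : ℝ≥0} (hFL : LipschitzOnWith L F (thickening ψ.rOut C)) :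
    LipschitzOnWith L (ψ.normed μ ⋆[lsmul ℝ ℝ, μ] F) C := by
  have h_exists : ConvolutionExists (ψ.normed μ) F (lsmul ℝ ℝ) μ :=
    ψ.hasCompactSupport_normed.convolutionExists_left_of_continuous_right _
      ψ.continuous_normed.locallyIntegrable hF
  refine LipschitzOnWith.of_dist_le_mul fun x hx y hy => ?_
  have h_mem {u z : E} (hu : u ∈ C) (hz : z ∈ ball 0 ψ.rOut) : u - z ∈ thickening ψ.rOut C :=
    mem_thickening_iff.2 ⟨u, hu, by simpa [dist_eq_norm] using hz⟩
  have h_bound (z : E) :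
      ‖ψ.normed μ z • (F (x - z) - F (y - z))‖ ≤ ψ.normed μ z * (L * dist x y) := by
    rw [norm_smul, Real.norm_of_nonneg (ψ.nonneg_normed z)]
    by_cases hz : z ∈ ball 0 ψ.rOut
    · have h := hFL.dist_le_mul _ (h_mem hx hz) _ (h_mem hy hz)
      rw [dist_sub_right, dist_eq_norm] at h
      exact mul_le_mul_of_nonneg_left h (ψ.nonneg_normed z)
    · rw [← ψ.support_normed_eq (μ := μ), Function.notMem_support] at hz
      simp [hz]
  rw [dist_eq_norm, convolution_lsmul_sub_convolution (h_exists x) (h_exists y)]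
  calc _ ≤ ∫ z, ψ.normed μ z * (L * dist x y) ∂μ :=
        norm_integral_le_of_norm_le (ψ.integrable_normed.mul_const _) (.of_forall h_bound)
    _ = L * dist x y := by rw [integral_mul_const, ψ.integral_normed, one_mul]

end Convolution

section FiniteRankApproximation

open MeasureTheory Metric
open scoped Convolution

variable {E V : Type*} [NormedAddCommGroup E] [NormedSpace ℝ E] [FiniteDimensional ℝ E]
  [NormedAddCommGroup V] [NormedSpace ℝ V] [CompleteSpace V] {F : E → V}

theorem exists_hasFiniteRank_lipschitzOnWith_near {M : ℝ≥0} (hF : LipschitzWith M F)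
    (hF_supp : HasCompactSupport F) {C : Set E} (hC : Bornology.IsBounded C) {r : ℝ} (hr : 0 < r)
    {L' L : ℝ≥0} (hL : L' < L) (hFL : LipschitzOnWith L' F (thickening r C)) {ε : ℝ} (hε : 0 < ε) :
    ∃ φ : E → V, HasFiniteRank φ ∧ LipschitzOnWith L φ C ∧ ∀ x ∈ C, dist (φ x) (F x) ≤ ε := by
  borelize E
  let μ : Measure E := Measure.addHaar
  obtain ⟨s, hs, hsr, hsM⟩ : ∃ s : ℝ, 0 < s ∧ s ≤ r ∧ M * s ≤ ε / 2 := by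
    refine ⟨min r (ε / (2 * (M + 1))), lt_min hr (by positivity), min_le_left _ _, ?_⟩
    calc (M : ℝ) * min r (ε / (2 * (M + 1))) ≤ (M + 1) * (ε / (2 * (M + 1))) := by
          gcongr
          · linarith
          · exact min_le_right _ _
      _ = ε / 2 := by field_simp
  let ψ : ContDiffBump (0 : E) := ⟨s / 2, s, half_pos hs, half_lt_self hs⟩
  set F₁ := ψ.normed μ ⋆[ContinuousLinearMap.lsmul ℝ ℝ, μ] F
  have hF₁_lip : LipschitzOnWith L' F₁ C :=
    lipschitzOnWith_normed_convolution μ ψ hF.continuous (hFL.mono (thickening_mono hsr C))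
  have hF₁_near (x : E) : dist (F₁ x) (F x) ≤ ε / 2 := by
    refine ψ.dist_normed_convolution_le hF.continuous.aestronglyMeasurable fun z hz => ?_
    calc dist (F z) (F x) ≤ M * dist z x := hF.dist_le_mul z x
      _ ≤ M * s := by gcongr; exact (mem_ball.1 hz).le
      _ ≤ ε / 2 := hsM
  obtain ⟨η, hη, hηL, hηε⟩ : ∃ η : ℝ≥0, 0 < η ∧ η ≤ L - L' ∧ η ≤ (ε / 2).toNNReal :=
    ⟨min (L - L') (ε / 2).toNNReal, lt_min (tsub_pos_of_lt hL) (by simpa using hε),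
      min_le_left _ _, min_le_right _ _⟩
  obtain ⟨φ, hφ_rank, hφ_lip, hφ_near⟩ :=
    exists_hasFiniteRank_near_convolution μ ⟨ψ.normed μ, ψ.continuous_normed⟩ hF hF_supp hC hη
  refine ⟨φ, hφ_rank, ?_, fun x hx => ?_⟩
  · have h_add : LipschitzOnWith (L' + η) (fun x => F₁ x + (φ x - F₁ x)) C := hF₁_lip.add hφ_lip
    simp only [add_sub_cancel] at h_add
    exact h_add.weaken ((add_le_add_right hηL L').trans (add_tsub_cancel_of_le hL.le).le)
  · calc dist (φ x) (F x) ≤ dist (φ x) (F₁ x) + dist (F₁ x) (F x) := dist_triangle _ _ _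
      _ ≤ ε / 2 + ε / 2 := by
        gcongr
        · rw [dist_eq_norm]
          exact (hφ_near x hx).trans (Real.coe_toNNReal _ (half_pos hε).le ▸ hηε)
        · exact hF₁_near x
      _ = ε := add_halves ε

end FiniteRankApproximation

section Extension

open Metric

theorem lipschitzWith_cutoff_smul {X V : Type*} [PseudoMetricSpace X] [NormedAddCommGroup V]
    [NormedSpace ℝ V] {χ : X → ℝ} {g : X → V} {U : Set X} {K L D : ℝ≥0} (hχ : LipschitzWith L χ)
    (hχ_le : ∀ x, ‖χ x‖ ≤ 1) (hχ_zero : ∀ x ∉ U, χ x = 0) (hg : LipschitzOnWith K g U)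
    (hgD : ∀ x ∈ U, ‖g x‖ ≤ D) : LipschitzWith (K + L * D) fun x => χ x • g x := by
  have h_cut {x y : X} (hx : x ∈ U) : ‖(χ x - χ y) • g x‖ ≤ L * dist x y * D := by
    rw [norm_smul, ← dist_eq_norm]
    exact mul_le_mul (hχ.dist_le_mul x y) (hgD x hx) (norm_nonneg _) (by positivity)
  have h_one_mem {x y : X} (hx : x ∈ U) :
      dist (χ x • g x) (χ y • g y) ≤ (K + L * D : ℝ≥0) * dist x y := by
    rw [NNReal.coe_add, NNReal.coe_mul, add_mul, dist_eq_norm]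
    by_cases hy : y ∈ U
    · have h_inner : ‖χ y • (g x - g y)‖ ≤ K * dist x y := by
        rw [norm_smul, ← dist_eq_norm]
        exact (mul_le_of_le_one_left dist_nonneg (hχ_le y)).trans (hg.dist_le_mul x hx y hy)
      calc ‖χ x • g x - χ y • g y‖ = ‖χ y • (g x - g y) + (χ x - χ y) • g x‖ := by
            congr 1; module
        _ ≤ K * dist x y + L * D * dist x y :=
          norm_add_le_of_le h_inner ((h_cut hx).trans_eq (by ring))
    · have h := h_cut (y := y) hx
      rw [hχ_zero y hy, sub_zero] at h
      rw [hχ_zero y hy, zero_smul, sub_zero]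
      calc ‖χ x • g x‖ ≤ L * D * dist x y := h.trans_eq (by ring)
        _ ≤ K * dist x y + L * D * dist x y := le_add_of_nonneg_left (by positivity)
  refine LipschitzWith.of_dist_le_mul fun x y => ?_
  by_cases hx : x ∈ U
  · exact h_one_mem hx
  by_cases hy : y ∈ U
  · rw [dist_comm, dist_comm x]
    exact h_one_mem hy
  · rw [hχ_zero x hx, hχ_zero y hy, zero_smul, zero_smul, dist_self]
    positivity

theorem exists_lipschitzWith_hasCompactSupport_eqOn {X V : Type*}
    [PseudoMetricSpace X] [ProperSpace X] [NormedAddCommGroup V] [NormedSpace ℝ V] {S : Set X}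
    (hS : Bornology.IsBounded S) {r : ℝ} (hr : 0 < r) {g : X → V} {K : ℝ≥0}
    (hg : LipschitzOnWith K g (thickening r S)) :
    ∃ (F : X → V) (M : ℝ≥0), LipschitzWith M F ∧ HasCompactSupport F ∧ EqOn F g S := by
  have hU : Bornology.IsBounded (thickening r S) := hS.thickening
  have h_image : Bornology.IsBounded (g '' thickening r S) :=
    isBounded_image_iff.2 ⟨K * diam (thickening r S), fun x hx y hy =>
      (hg.dist_le_mul x hx y hy).trans (by gcongr; exact dist_le_diam_of_mem hU hx hy)⟩
  obtain ⟨D, hD⟩ := h_image.exists_norm_le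
  have hgD (x : X) (hx : x ∈ thickening r S) : ‖g x‖ ≤ D.toNNReal :=
    (hD _ (mem_image_of_mem g hx)).trans (Real.le_coe_toNNReal D)
  let χ : X → ℝ := fun x => thickenedIndicator hr S x
  have hχ_lip : LipschitzWith (1 * r.toNNReal⁻¹) χ :=
    (LipschitzWith.subtype_val _).comp (lipschitzWith_thickenedIndicator hr S)
  have hχ_zero (x : X) (hx : x ∉ thickening r S) : χ x = 0 := by
    simp only [χ, thickenedIndicator_zero hr S hx, NNReal.coe_zero]
  refine ⟨fun x => χ x • g x, _, lipschitzWith_cutoff_smul hχ_lip ?_ hχ_zero hg hgD, ?_,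
    fun x hx => ?_⟩
  · intro x
    rw [NNReal.norm_eq]
    exact_mod_cast thickenedIndicator_le_one hr S x
  · refine .intro hS.cthickening.isCompact_closure (K := closure (cthickening r S)) fun x hx => ?_
    have hx' : x ∉ thickening r S := fun h =>
      hx (subset_closure (thickening_subset_cthickening r S h))
    rw [hχ_zero x hx', zero_smul]
  · simp only [χ, thickenedIndicator_one hr S hx, NNReal.coe_one, one_smul]

variable {E V : Type*} [NormedAddCommGroup E] [NormedSpace ℝ E] [FiniteDimensional ℝ E]
  [NormedAddCommGroup V] [NormedSpace ℝ V] {C : Set E}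

theorem exists_mapsTo_homothety_thickening (hC : Convex ℝ C) (hC_bdd : Bornology.IsBounded C)
    {c : E} (hc : c ∈ interior C) {q : ℝ} (hq0 : 0 < q) (hq1 : q < 1) :
    ∃ r > 0, MapsTo (AffineMap.homothety c q) (thickening r C) C := by
  obtain ⟨r, hr, hrC⟩ := hC_bdd.isCompact_closure.exists_thickening_subset_open isOpen_interior
    (hC.closure_subset_interior_image_homothety_of_one_lt hc q⁻¹ (one_lt_inv₀ hq0 |>.2 hq1))
  refine ⟨r, hr, fun x hx => ?_⟩
  obtain ⟨y, hy, rfl⟩ := interior_subset (hrC (thickening_subset_of_subset r subset_closure hx))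
  rwa [← AffineMap.homothety_mul_apply, mul_inv_cancel₀ hq0.ne', AffineMap.homothety_one]

theorem exists_lipschitzWith_hasCompactSupport_near (hC : Convex ℝ C)
    (hC_bdd : Bornology.IsBounded C) (hC_int : (interior C).Nonempty) {f : E → V} {K : ℝ≥0}
    (hK : 0 < K) (hf : LipschitzOnWith K f C) {ε : ℝ} (hε : 0 < ε) :
    ∃ L < K, ∃ r > 0, ∃ (F : E → V) (M : ℝ≥0), LipschitzWith M F ∧ HasCompactSupport F ∧
      LipschitzOnWith L F (thickening r C) ∧ ∀ x ∈ C, dist (F x) (f x) ≤ ε := by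
  obtain ⟨c, hc⟩ := hC_int
  obtain ⟨R, hR⟩ := hC_bdd.subset_closedBall c
  obtain ⟨q, ⟨hq0, hq1⟩, hqε⟩ : ∃ q : ℝ, (0 < q ∧ q < 1) ∧ K * ((1 - q) * R) ≤ ε := by
    have h_tendsto : Tendsto (fun q : ℝ => K * ((1 - q) * R)) (𝓝[<] 1) (𝓝 0) :=
      tendsto_nhdsWithin_of_tendsto_nhds (Continuous.tendsto' (by fun_prop) _ _ (by simp))
    have h_Ioo : ∀ᶠ q : ℝ in 𝓝[<] 1, 0 < q ∧ q < 1 := Ioo_mem_nhdsLT zero_lt_one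
    exact (h_Ioo.and (h_tendsto.eventually_le_const hε)).exists
  lift q to ℝ≥0 using hq0.le
  let h : E → E := AffineMap.homothety c (q : ℝ)
  have hh : LipschitzWith q h := LipschitzWith.of_dist_le_mul fun x y => by
    simp [h, AffineMap.homothety_apply, dist_smul₀]
  obtain ⟨r, hr, h_maps⟩ := exists_mapsTo_homothety_thickening hC hC_bdd hc hq0 hq1
  have h_comp : LipschitzOnWith (K * q) (f ∘ h) (thickening r C) :=
    hf.comp hh.lipschitzOnWith h_maps
  have h_halves : thickening (r / 2) (thickening (r / 2) C) ⊆ thickening r C :=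
    (thickening_thickening_subset _ _ _).trans_eq (by rw [add_halves])
  obtain ⟨F, M, hF, hF_supp, hF_eq⟩ :=
    exists_lipschitzWith_hasCompactSupport_eqOn hC_bdd.thickening (half_pos hr)
      (h_comp.mono h_halves)
  refine ⟨K * q, mul_lt_of_lt_one_right hK hq1, r / 2, half_pos hr, F, M, hF, hF_supp,
    fun x hx y hy => ?_, fun x hx => ?_⟩
  · rw [hF_eq hx, hF_eq hy]
    exact h_comp.mono (thickening_mono (half_le_self hr.le) C) hx hy
  · rw [hF_eq (self_subset_thickening (half_pos hr) C hx)]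
    calc dist (f (h x)) (f x) ≤ K * dist (h x) x :=
          hf.dist_le_mul _ (h_maps (self_subset_thickening hr C hx)) _ hx
      _ = K * ((1 - q) * dist c x) := by
        rw [dist_homothety_self, Real.norm_of_nonneg (sub_nonneg.2 hq1.le)]
      _ ≤ K * ((1 - q) * R) := by
        have := mem_closedBall'.1 (hR hx)
        have := sub_nonneg.2 hq1.le
        gcongr
      _ ≤ ε := hqε

theorem exists_hasFiniteRank_lipschitzOnWith_near_of_convex [CompleteSpace V] (hC : Convex ℝ C)
    (hC_bdd : Bornology.IsBounded C) (hC_int : (interior C).Nonempty) {f : E → V} {K : ℝ≥0}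
    (hK : 0 < K) (hf : LipschitzOnWith K f C) {ε : ℝ} (hε : 0 < ε) :
    ∃ φ : E → V, HasFiniteRank φ ∧ LipschitzOnWith K φ C ∧ ∀ x ∈ C, dist (φ x) (f x) ≤ ε := by
  obtain ⟨L, hL, r, hr, F, M, hF, hF_supp, hFL, hF_near⟩ :=
    exists_lipschitzWith_hasCompactSupport_near hC hC_bdd hC_int hK hf (half_pos hε)
  obtain ⟨φ, hφ_rank, hφ_lip, hφ_near⟩ :=
    exists_hasFiniteRank_lipschitzOnWith_near hF hF_supp hC_bdd hr hL hFL (half_pos hε)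
  exact ⟨φ, hφ_rank, hφ_lip, fun x hx => (dist_triangle _ (F x) _).trans
    ((add_le_add (hφ_near x hx) (hF_near x hx)).trans_eq (add_halves ε))⟩

end Extension

section ConvexSubset

variable {X V M : Type*} [NormedAddCommGroup X] [NormedSpace ℝ X] [NormedAddCommGroup V]
  [NormedSpace ℝ V]

theorem nonempty_interior_preimage_span {C : Set X} (hC : Convex ℝ C) (h0 : 0 ∈ C)
    [FiniteDimensional ℝ (Submodule.span ℝ C)] :
    (interior ((↑) ⁻¹' C : Set (Submodule.span ℝ C))).Nonempty := by
  have h0' : (0 : Submodule.span ℝ C) ∈ ((↑) ⁻¹' C : Set (Submodule.span ℝ C)) := h0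
  have hC' : Convex ℝ ((↑) ⁻¹' C : Set (Submodule.span ℝ C)) :=
    hC.linear_preimage (Submodule.span ℝ C).subtype
  rw [hC'.interior_nonempty_iff_affineSpan_eq_top, ← insert_eq_of_mem h0',
    ← AffineSubspace.coe_eq_univ_iff, affineSpan_insert_zero, Submodule.span_span_coe_preimage,
    Submodule.top_coe]

variable [CompleteSpace V]

theorem exists_hasFiniteRank_lipschitzWith_near {C : Set X} (hC : Convex ℝ C)
    (hC_bdd : Bornology.IsBounded C) (h0 : 0 ∈ C) [FiniteDimensional ℝ (Submodule.span ℝ C)]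
    {f : C → V} {k : ℝ≥0} (hk : 0 < k) (hf : LipschitzWith k f) {ε : ℝ} (hε : 0 < ε) :
    ∃ φ : C → V, HasFiniteRank φ ∧ LipschitzWith k φ ∧ ∀ x, dist (φ x) (f x) ≤ ε := by
  let E := Submodule.span ℝ C
  let C' : Set E := (↑) ⁻¹' C
  let j : C → E := fun x => ⟨x, Submodule.subset_span x.2⟩
  let g : E → V := Function.extend j f 0
  have hj_mem (x : C) : j x ∈ C' := x.2
  have hj : Function.Injective j := fun _ _ h => Subtype.ext (congr_arg E.subtype h)
  have hg_apply (x : C) : g (j x) = f x := hj.extend_apply f 0 x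
  have hg_lip : LipschitzOnWith k g C' := fun x hx y hy => by
    rw [hg_apply ⟨x, hx⟩, hg_apply ⟨y, hy⟩]
    exact hf ⟨x, hx⟩ ⟨y, hy⟩
  obtain ⟨φ, hφ_rank, hφ_lip, hφ_near⟩ :=
    exists_hasFiniteRank_lipschitzOnWith_near_of_convex (hC.linear_preimage E.subtype)
      (isometry_subtype_coe.antilipschitz.isBounded_preimage hC_bdd)
      (nonempty_interior_preimage_span hC h0) hk hg_lip hε
  exact ⟨φ ∘ j, hφ_rank.comp j, fun x y => hφ_lip (hj_mem x) (hj_mem y),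
    fun x => hg_apply x ▸ hφ_near (j x) (hj_mem x)⟩

theorem exists_hasFiniteRank_lipschitzWith_near_comp [PseudoMetricSpace M] {K : Set X}
    (hK : Convex ℝ K) (h0 : 0 ∈ K) {δ : K → V} {k l : ℝ≥0} (hk : 0 < k) (hδ : LipschitzWith k δ)
    {S : M → K} (hS : LipschitzWith l S) (hS_rank : HasFiniteRank fun x => (S x : X))
    (hS_bdd : Bornology.IsBounded (range S)) {ε : ℝ} (hε : 0 < ε) :
    ∃ φ : M → V, HasFiniteRank φ ∧ LipschitzWith (k * l) φ ∧ ∀ x, dist (φ x) (δ (S x)) ≤ ε := by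
  let A : Set X := range fun x => (S x : X)
  let C := convexHull ℝ (insert 0 A)
  have hA : Bornology.IsBounded A := by
    rwa [← Bornology.isBounded_image_subtype_val, ← range_comp] at hS_bdd
  have hCK : C ⊆ K := convexHull_min
    (insert_subset h0 (range_subset_iff.2 fun x => (S x).2)) hK
  have hC_span : C ⊆ Submodule.span ℝ A := convexHull_min
    (insert_subset (zero_mem _) Submodule.subset_span) (Submodule.span ℝ A).convex
  have : FiniteDimensional ℝ (Submodule.span ℝ A) := hS_rank
  have : FiniteDimensional ℝ (Submodule.span ℝ C) :=
    Submodule.finiteDimensional_of_le (Submodule.span_le.2 hC_span)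
  let S' : M → C := fun x =>
    ⟨S x, subset_convexHull ℝ _ (mem_insert_of_mem 0 (mem_range_self x))⟩
  have h_incl : LipschitzWith 1 (inclusion hCK) := .of_edist_le fun _ _ => le_rfl
  have hδC : LipschitzWith k (δ ∘ inclusion hCK) := mul_one k ▸ hδ.comp h_incl
  obtain ⟨φ, hφ_rank, hφ_lip, hφ_near⟩ := exists_hasFiniteRank_lipschitzWith_near
    (convex_convexHull ℝ _) (isBounded_convexHull.2 (hA.insert 0))
    (subset_convexHull ℝ _ (mem_insert 0 A)) hk hδC hε
  exact ⟨φ ∘ S', hφ_rank.comp S', hφ_lip.comp fun x y => hS x y, fun x => hφ_near (S' x)⟩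

end ConvexSubset

section RadialContraction

variable {X : Type*} [NormedAddCommGroup X] [NormedSpace ℝ X] {η : ℝ}

/-- A nonexpansive map of the normed space `X` into a bounded set, which moves every point along
the segment to the origin and tends to the identity as `η → 0`. -/
noncomputable def radialContraction (η : ℝ) (x : X) : X := (1 + η * ‖x‖)⁻¹ • x

theorem norm_radialContraction_sub_le (hη : 0 ≤ η) (x y : X) :
    ‖radialContraction η x - radialContraction η y‖ ≤ ‖x - y‖ := by
  wlog hxy : ‖y‖ ≤ ‖x‖ generalizing x y
  · rw [norm_sub_rev, norm_sub_rev x]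
    exact this y x (not_le.1 hxy).le
  have h_sub : (1 + η * ‖y‖)⁻¹ - (1 + η * ‖x‖)⁻¹ =
      η * (‖x‖ - ‖y‖) * ((1 + η * ‖x‖)⁻¹ * (1 + η * ‖y‖)⁻¹) := by
    field_simp
    ring
  have h_nonneg : 0 ≤ η * (‖x‖ - ‖y‖) * ((1 + η * ‖x‖)⁻¹ * (1 + η * ‖y‖)⁻¹) := by
    have := sub_nonneg.2 hxy
    positivity
  have h_inv_le : (1 + η * ‖y‖)⁻¹ ≤ 1 :=
    inv_le_one_of_one_le₀ (le_add_of_nonneg_right (by positivity))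
  calc ‖radialContraction η x - radialContraction η y‖
      = ‖(1 + η * ‖x‖)⁻¹ • (x - y) - ((1 + η * ‖y‖)⁻¹ - (1 + η * ‖x‖)⁻¹) • y‖ := by
        rw [radialContraction, radialContraction]
        congr 1
        module
    _ ≤ (1 + η * ‖x‖)⁻¹ * ‖x - y‖ +
        η * (‖x‖ - ‖y‖) * ((1 + η * ‖x‖)⁻¹ * (1 + η * ‖y‖)⁻¹) * ‖y‖ := by
      refine (norm_sub_le _ _).trans_eq ?_
      rw [h_sub, norm_smul, norm_smul, Real.norm_of_nonneg h_nonneg,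
        Real.norm_of_nonneg (by positivity)]
    _ ≤ (1 + η * ‖x‖)⁻¹ * ‖x - y‖ + η * ‖x - y‖ * ((1 + η * ‖x‖)⁻¹ * 1) * ‖x‖ := by
      gcongr
      exact norm_sub_norm_le x y
    _ = ‖x - y‖ := by field_simp

theorem lipschitzWith_radialContraction (hη : 0 ≤ η) :
    LipschitzWith 1 (radialContraction η : X → X) :=
  .of_dist_le_mul fun x y => by
    simpa [dist_eq_norm] using norm_radialContraction_sub_le hη x y

theorem norm_radialContraction_le (hη : 0 < η) (x : X) : ‖radialContraction η x‖ ≤ η⁻¹ := by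
  rw [radialContraction, norm_smul, Real.norm_of_nonneg (by positivity),
    inv_mul_le_iff₀ (by positivity)]
  calc ‖x‖ ≤ η⁻¹ + ‖x‖ := le_add_of_nonneg_left (by positivity)
    _ = (1 + η * ‖x‖) * η⁻¹ := by field_simp

theorem radialContraction_mem {K : Set X} (hK : Convex ℝ K) (h0 : 0 ∈ K) (hη : 0 ≤ η)
    {x : X} (hx : x ∈ K) : radialContraction η x ∈ K :=
  hK.smul_mem_of_zero_mem h0 hx ⟨by positivity,
    inv_le_one_of_one_le₀ (le_add_of_nonneg_right (by positivity))⟩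

theorem tendsto_radialContraction (x : X) :
    Tendsto (fun η => radialContraction η x) (𝓝 0) (𝓝 x) := by
  have h : ContinuousAt (fun η : ℝ => (1 + η * ‖x‖)⁻¹ • x) 0 :=
    ContinuousAt.smul (ContinuousAt.inv₀ (by fun_prop) (by simp)) continuousAt_const
  simpa [ContinuousAt] using! h

end RadialContraction

section Truncation

variable {X ι : Type*} [NormedAddCommGroup X] [NormedSpace ℝ X] {K : Set X} {l : ℝ≥0}
  {u : Filter ι} [u.NeBot] {T : ι → K → K}

theorem exists_lipschitzWith_isBounded_range_near (hK : Convex ℝ K) (h0 : 0 ∈ K)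
    (hT_lip : ∀ i, LipschitzWith l (T i)) (hT_rank : ∀ i, HasFiniteRank fun x => (T i x : X))
    (hT_tendsto : ∀ x, Tendsto (fun i => T i x) u (𝓝 x)) (P : Finset K) {ε : ℝ} (hε : 0 < ε) :
    ∃ S : K → K, LipschitzWith l S ∧ HasFiniteRank (fun x => (S x : X)) ∧
      Bornology.IsBounded (range S) ∧ ∀ p ∈ P, dist (S p) p ≤ ε := by
  obtain ⟨η, hη, hη_near⟩ :
      ∃ η : ℝ, 0 < η ∧ ∀ p ∈ P, dist (radialContraction η (p : X)) p < ε / 2 := by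
    have h_near : ∀ᶠ η in 𝓝[>] 0, ∀ p ∈ P, dist (radialContraction η (p : X)) p < ε / 2 :=
      (Finset.eventually_all P).2 fun p _ => ((tendsto_radialContraction (p : X)).mono_left
        nhdsWithin_le_nhds).eventually (Metric.ball_mem_nhds _ (half_pos hε))
    exact (eventually_mem_nhdsWithin.and h_near).exists
  let R : K → K := fun x => ⟨radialContraction η x, radialContraction_mem hK h0 hη.le x.2⟩
  have hR_lip : LipschitzWith 1 R := fun x y => lipschitzWith_radialContraction hη.le (x : X) y
  have hR_bdd : Bornology.IsBounded (range R) := by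
    rw [← Bornology.isBounded_image_subtype_val]
    refine isBounded_iff_forall_norm_le.2 ⟨η⁻¹, ?_⟩
    rintro _ ⟨_, ⟨x, rfl⟩, rfl⟩
    exact norm_radialContraction_le hη (x : X)
  obtain ⟨i, hi⟩ : ∃ i, ∀ p ∈ P, dist (T i (R p)) (R p) < ε / 2 :=
    ((Finset.eventually_all P).2 fun p _ =>
      (hT_tendsto (R p)).eventually (Metric.ball_mem_nhds _ (half_pos hε))).exists
  refine ⟨T i ∘ R, by simpa using (hT_lip i).comp hR_lip, (hT_rank i).comp R, ?_, fun p hp => ?_⟩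
  · rw [range_comp]
    exact (hT_lip i).isBounded_image hR_bdd
  · calc dist (T i (R p)) p ≤ dist (T i (R p)) (R p) + dist (R p) p := dist_triangle _ _ _
      _ ≤ ε / 2 + ε / 2 := add_le_add (hi p hp).le (hη_near p hp).le
      _ = ε := add_halves ε

theorem IsFreeEmbedding.hasBAP_of_convex {E : Type*} [NormedAddCommGroup E] [NormedSpace ℝ E]
    [CompleteSpace E] (hK : Convex ℝ K) {h0 : 0 ∈ K} {δ : K → E}
    (hδ : IsFreeEmbedding ⟨0, h0⟩ δ) (hl : 0 < l)
    (hT_lip : ∀ i, LipschitzWith l (T i)) (hT_rank : ∀ i, HasFiniteRank fun x => (T i x : X))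
    (hT_tendsto : ∀ x, Tendsto (fun i => T i x) u (𝓝 x)) : HasBAP l E := by
  refine hδ.hasBAP_of_forall_finset hl fun P ε hε => ?_
  obtain ⟨S, hS_lip, hS_rank, hS_bdd, hS_near⟩ :=
    exists_lipschitzWith_isBounded_range_near hK h0 hT_lip hT_rank hT_tendsto P (half_pos hε)
  obtain ⟨φ, hφ_rank, hφ_lip, hφ_near⟩ := exists_hasFiniteRank_lipschitzWith_near_comp hK h0
    zero_lt_one hδ.lipschitzWith hS_lip hS_rank hS_bdd (half_pos hε)
  refine ⟨φ, hφ_rank, one_mul l ▸ hφ_lip, fun p hp => ?_⟩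
  have hδS_near : dist (δ (S p)) (δ p) ≤ ε / 2 := by
    simpa using (hδ.lipschitzWith.dist_le_mul (S p) p).trans_eq (one_mul _) |>.trans (hS_near p hp)
  calc dist (φ p) (δ p) ≤ dist (φ p) (δ (S p)) + dist (δ (S p)) (δ p) := dist_triangle _ _ _
    _ ≤ ε / 2 + ε / 2 := add_le_add (hφ_near p) hδS_near
    _ = ε := add_halves ε

end Truncation

theorem proposition2_general {X ι : Type*} [NormedAddCommGroup X] [NormedSpace ℝ X] {K : Set X}
    (hK : Convex ℝ K) (h0 : 0 ∈ K) {l : ℝ≥0} (hl : 0 < l) {u : Filter ι} [u.NeBot]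
    {T : ι → K → K} (hT_lip : ∀ i, LipschitzWith l (T i))
    (hT_rank : ∀ i, HasFiniteRank fun x => (T i x : X))
    (hT_tendsto : ∀ x, Tendsto (fun i => T i x) u (𝓝 x)) :
    HasBAP l (LipschitzFree K ⟨0, h0⟩) :=
  (LipschitzFree.isFreeEmbedding_ofPoint _).hasBAP_of_convex hK hl hT_lip hT_rank hT_tendsto

theorem proposition2 {X : Type*} [NormedAddCommGroup X] [NormedSpace ℝ X] [CompleteSpace X]
    (K : Set X) (hK_closed : IsClosed K) (hK_convex : Convex ℝ K) (h0 : (0 : X) ∈ K)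
    (l : ℝ) (hl : 1 ≤ l) (T : ℕ → X →L[ℝ] X)
    (hT_finite : ∀ n, FiniteDimensional ℝ (T n).range)
    (hT_norm : ∀ n, ‖T n‖ ≤ l)
    (hT_maps : ∀ n, Set.MapsTo (T n) K K)
    (hT_tendsto : ∀ x ∈ K, Filter.Tendsto (fun n => T n x) Filter.atTop (nhds x)) :
    HasBAP l (LipschitzFree K ⟨0, h0⟩) := by
  lift l to NNReal using zero_le_one.trans hl
  have hT_lip (n : ℕ) : LipschitzWith l ((hT_maps n).restrict (T n) K K) :=
    ((T n).lipschitzWith_of_opNorm_le (hT_norm n)).lipschitzOnWith.mapsToRestrict (hT_maps n)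
  have hT_rank (n : ℕ) : HasFiniteRank fun x : K => T n x :=
    have := hT_finite n
    .of_forall_mem (T n).range fun x => LinearMap.mem_range_self _ (x : X)
  exact proposition2_general hK_convex h0 (one_pos.trans_le hl) hT_lip hT_rank fun x =>
    tendsto_subtype_rng.2 (hT_tendsto x x.2)
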